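/- An oriented graph is a finite directed graph without directed cycles of length one or two. An oriented $k$-colouring of an oriented graph $G$ is a map $\phi : V(G) \to \{1,\dots,k\}$ such that $\phi(x) \neq \phi(y)$ for every arc $xy$, and such that for all arcs $xy$ and $uv$, if $\phi(x) = \phi(v)$ then $\phi(y) \neq \phi(u)$. The oriented chromatic number $\chi_o(G)$ is the least $k$ for which $G$ has an oriented $k$-colouring. A deeply critical oriented clique is an oriented graph $G$ such that $\chi_o(G) = |V(G)|$ and $\chi_o(G - xy) = \chi_o(G) - 2$ for every arc $xy$ of $G$, where $G - xy$ is obtained from $G$ by deleting the arc $xy$ and keeping all vertices. **Theorem.** Let $n \geq 3$ be an odd integer. There exists a deeply critical oriented clique of order $n$ (that is, with $n$ vertices) if and only if $n \geq 5$ and $n \neq 7$. -/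

import Mathlib

/-- An oriented graph: a directed graph without directed cycles of length one or two. -/
structure OrientedGraph (V : Type*) extends Digraph V where
  /-- There are no loops. -/
  irrefl : ∀ v, ¬ Adj v v
  /-- There are no directed cycles of length two. -/
  asymm : ∀ u v, Adj u v → ¬ Adj v u

namespace OrientedGraph

variable {V : Type*}

/-- The oriented graph `G - xy` obtained by deleting the arc from `x` to `y`
(all vertices and all other arcs stay). -/
def deleteArc (G : OrientedGraph V) (x y : V) : OrientedGraph V where
  Adj u v := G.Adj u v ∧ ¬ (u = x ∧ v = y)
  irrefl v h := G.irrefl v h.1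
  asymm u v h h' := G.asymm u v h.1 h'.1

/-- `φ` is an oriented colouring of `G`: the ends of an arc get different colours, and all arcs
between two colour classes point in the same direction. -/
structure IsOrientedColouring (G : OrientedGraph V) {C : Type*} (φ : V → C) : Prop where
  ne_of_adj : ∀ x y, G.Adj x y → φ x ≠ φ y
  antisymm : ∀ x y u v, G.Adj x y → G.Adj u v → φ x = φ v → φ y ≠ φ u

/-- An oriented graph on a finite vertex set has an oriented `|V|`-colouring, so that the minimum
in the definition of the oriented chromatic number is attained. -/
theorem exists_isOrientedColouring [Fintype V] (G : OrientedGraph V) :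
    ∃ φ : V → Fin (Fintype.card V), G.IsOrientedColouring φ := by
  let e := Fintype.equivFin V
  refine ⟨e, fun x y h hxy => ?_, fun x y u v h h' hxv hyu => ?_⟩
  · rw [e.injective hxy] at h
    exact G.irrefl y h
  · rw [e.injective hxv, e.injective hyu] at h
    exact G.asymm u v h' h

/-- The oriented chromatic number: the least `k` such that `G` has an oriented `k`-colouring. -/
noncomputable def orientedChromaticNumber (G : OrientedGraph V) : ℕ :=
  sInf {k : ℕ | ∃ φ : V → Fin k, G.IsOrientedColouring φ}

/-- An absolute oriented clique: the oriented chromatic number is the number of vertices. -/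
def IsAbsoluteOrientedClique [Fintype V] (G : OrientedGraph V) : Prop :=
  G.orientedChromaticNumber = Fintype.card V

/-- A deeply critical oriented graph: the deletion of any arc decreases the oriented chromatic
number by exactly two. -/
def IsDeeplyCritical (G : OrientedGraph V) : Prop :=
  ∀ x y, G.Adj x y →
    (G.deleteArc x y).orientedChromaticNumber + 2 = G.orientedChromaticNumber

/-- A deeply critical oriented clique: a deeply critical oriented graph that is also an absolute
oriented clique. -/
def IsDeeplyCriticalOrientedClique [Fintype V] (G : OrientedGraph V) : Prop :=
  G.IsAbsoluteOrientedClique ∧ G.IsDeeplyCritical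

end OrientedGraph

/-!
An oriented graph is a deeply critical oriented clique if and only if any two vertices see each
other, that is, are adjacent or joined by a directed path of length two, and each arc `xy` extends
to paths `x → y → w` and `w' → x → y` that are *sole*: the ends of the path are not adjacent, and
no other directed path of length two joins them (`isDeeplyCriticalOrientedClique_iff`). Indeed
vertices that see each other have different colours. If each arc extends to such sole paths, then
`w` can share the colour of `x`, and `w'` that of `y`, in `G - xy`, which saves two colours, and
more cannot be saved, since new colours for `x` and `y` give a colouring of `G` back. Conversely, a
colouring of `G - xy` that saves two colours must use the colours of `x` and of `y` on further
vertices.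

*Orders three and seven.* The sole paths starting or ending at a vertex give it as many
non-neighbours as it has neighbours, so that its degree is at most `(n - 1) / 2`
(`two_mul_degree_add_one_le`). As there are neither sources nor sinks, `n = 3` is impossible. For
`n = 7` the handshake lemma yields a vertex `v` with a single in-neighbour `u` and a single
out-neighbour `w`. The other four vertices are out-neighbours of `w` or in-neighbours of `u`, and
sole paths match these two sets (`IsSevenConfig`). Few further arcs are possible, and none of them
is compatible with the sole paths that it requires (`not_isSevenConfig`).

*Existence.* A core is extended by `k` blocks of four vertices, indexed by `Fin k`. The arcs between
a block and the core do not depend on the block, and those between two blocks only on their order.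
Two vertices meet at most two blocks, and the vertices that witness the conditions for them can be
chosen in these blocks and the core. For the uniqueness of a sole path, a vertex outside these
blocks matters only through its type and through the gap in which its block lies. So the conditions
for all `k` follow from a finite check with at most two blocks and the gaps around them
(`CoreData.IsStable`, `CoreData.isDeeplyCriticalOrientedClique_toOrientedGraph`). Two cores pass the
check, the directed five-cycle and a graph of order eleven, and give the orders `5 + 4 k` and
`11 + 4 k`, that is, all odd orders from five on except seven.
-/

namespace OrientedGraph

/-! ### Deeply critical oriented cliques and sole paths -/

variable {V : Type*}

/-- Two vertices see each other: they are adjacent or joined by a directed path of length two. -/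
def Sees (G : OrientedGraph V) (u v : V) : Prop :=
  G.Adj u v ∨ G.Adj v u ∨ ∃ z, (G.Adj u z ∧ G.Adj z v) ∨ (G.Adj v z ∧ G.Adj z u)

/-- `x → y → w` is a directed path between non-adjacent vertices, and it is the only directed path
of length two between `x` and `w`, in either direction. -/
structure IsSolePath (G : OrientedGraph V) (x y w : V) : Prop where
  fst : G.Adj x y
  snd : G.Adj y w
  not_adj : ¬ G.Adj x w
  not_adj' : ¬ G.Adj w x
  eq_of_adj : ∀ z, G.Adj x z → G.Adj z w → z = y
  not_path : ∀ z, G.Adj w z → ¬ G.Adj z x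

theorem orientedChromaticNumber_le [Fintype V] [DecidableEq V] (G : OrientedGraph V) {C : Type*}
    [DecidableEq C] {φ : V → C} (h : G.IsOrientedColouring φ) :
    G.orientedChromaticNumber ≤ (Finset.univ.image φ).card := by
  let e := (Finset.univ.image φ).equivFin
  refine Nat.sInf_le ⟨fun v => e ⟨φ v, Finset.mem_image_of_mem φ (Finset.mem_univ v)⟩, ?_, ?_⟩
  · intro x y hxy he
    exact h.ne_of_adj x y hxy (by simpa using he)
  · intro x y u v hxy huv h1 h2
    exact h.antisymm x y u v hxy huv (by simpa using h1) (by simpa using h2)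

theorem orientedChromaticNumber_le_card [Fintype V] (G : OrientedGraph V) :
    G.orientedChromaticNumber ≤ Fintype.card V :=
  Nat.sInf_le G.exists_isOrientedColouring

theorem exists_colouring [Fintype V] (G : OrientedGraph V) :
    ∃ φ : V → Fin G.orientedChromaticNumber, G.IsOrientedColouring φ :=
  Nat.sInf_mem (s := {k : ℕ | ∃ φ : V → Fin k, G.IsOrientedColouring φ})
    ⟨_, G.exists_isOrientedColouring⟩

theorem card_image_le_sub_one [Fintype V] [DecidableEq V] {φ : V → V} {a : V}
    (h : ∀ v, φ v ≠ a) : (Finset.univ.image φ).card + 1 ≤ Fintype.card V := by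
  have : Finset.univ.image φ ⊆ Finset.univ.erase a := by
    intro b hb
    obtain ⟨v, -, rfl⟩ := Finset.mem_image.1 hb
    exact Finset.mem_erase.2 ⟨h v, Finset.mem_univ _⟩
  have h2 := Finset.card_le_card this
  have h3 := Finset.card_erase_add_one (Finset.mem_univ a)
  rw [Finset.card_univ] at h3
  omega

theorem card_image_le_sub_two [Fintype V] [DecidableEq V] {φ : V → V} {a b : V} (hab : a ≠ b)
    (ha : ∀ v, φ v ≠ a) (hb : ∀ v, φ v ≠ b) :
    (Finset.univ.image φ).card + 2 ≤ Fintype.card V := by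
  have : Finset.univ.image φ ⊆ (Finset.univ.erase a).erase b := by
    intro c hc
    obtain ⟨v, -, rfl⟩ := Finset.mem_image.1 hc
    exact Finset.mem_erase.2 ⟨hb v, Finset.mem_erase.2 ⟨ha v, Finset.mem_univ _⟩⟩
  have h2 := Finset.card_le_card this
  have h3 := Finset.card_erase_add_one (Finset.mem_univ a)
  have h4 := Finset.card_erase_add_one (Finset.mem_erase.2 ⟨hab.symm, Finset.mem_univ b⟩)
  rw [Finset.card_univ] at h3
  omega

/-- Vertices of the same colour do not see each other. -/
theorem IsOrientedColouring.not_sees {G : OrientedGraph V} {C : Type*} {φ : V → C}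
    (h : G.IsOrientedColouring φ) {u v : V} (e : φ u = φ v) : ¬ G.Sees u v := by
  rintro (h1 | h1 | ⟨z, ⟨h1, h2⟩ | ⟨h1, h2⟩⟩)
  · exact h.ne_of_adj _ _ h1 e
  · exact h.ne_of_adj _ _ h1 e.symm
  · exact h.antisymm _ _ _ _ h1 h2 e rfl
  · exact h.antisymm _ _ _ _ h1 h2 e.symm rfl

theorem isAbsoluteOrientedClique_iff [Fintype V] (G : OrientedGraph V) :
    G.IsAbsoluteOrientedClique ↔ ∀ u v, u ≠ v → G.Sees u v := by
  classical
  constructor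
  · intro hG u v huv
    by_contra hs
    have hc : G.IsOrientedColouring (fun z => if z = v then u else z) := by
      unfold Sees at hs
      push Not at hs
      obtain ⟨h1, h2, h3⟩ := hs
      have hi := G.irrefl
      have ha := G.asymm
      constructor
      · intro x y hxy
        grind
      · intro x y p q hxy hpq
        have h4 := h3 x
        have h5 := h3 y
        grind
    have h1 := G.orientedChromaticNumber_le hc
    have h2 := card_image_le_sub_one (φ := fun z => if z = v then u else z) (a := v) (by
      intro z; grind)
    rw [IsAbsoluteOrientedClique] at hG
    omega
  · intro h
    refine le_antisymm G.orientedChromaticNumber_le_card ?_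
    obtain ⟨φ, hφ⟩ := G.exists_colouring
    have hinj : Function.Injective φ := fun u v e => by
      by_contra hne
      exact hφ.not_sees e (h u v hne)
    simpa using Fintype.card_le_of_injective φ hinj

/-- Two new colours for `x` and `y` turn an oriented colouring of `G - xy` into one of `G`. -/
theorem orientedChromaticNumber_le_deleteArc_add_two [Fintype V] (G : OrientedGraph V) (x y : V) :
    G.orientedChromaticNumber ≤ (G.deleteArc x y).orientedChromaticNumber + 2 := by
  classical
  obtain ⟨φ, hφ⟩ := (G.deleteArc x y).exists_colouring
  have hc : G.IsOrientedColouring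
      (fun z => if z = x then none else if z = y then some none else some (some (φ z))) := by
    have h1 : ∀ p q, p ≠ x → p ≠ y → G.Adj p q → (G.deleteArc x y).Adj p q :=
      fun p q h _ h' => ⟨h', fun h'' => h h''.1⟩
    have h2 : ∀ p q, q ≠ x → q ≠ y → G.Adj p q → (G.deleteArc x y).Adj p q :=
      fun p q _ h h' => ⟨h', fun h'' => h h''.2⟩
    have hi := G.irrefl
    have ha := G.asymm
    obtain ⟨h3, h4⟩ := hφ
    constructor
    · intro p q hpq
      have := h3 p q
      grind
    · intro p q r s hpq hrs
      have := h4 p q r s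
      grind
  refine (G.orientedChromaticNumber_le hc).trans ?_
  refine (Finset.card_le_univ _).trans ?_
  simp

/-- In `G - xy` the vertices `w` and `x` no longer see each other, nor do `w'` and `y`, so that `w`
may take the colour of `x` and `w'` that of `y`. -/
theorem deleteArc_colouring_of_solePath {G : OrientedGraph V} [DecidableEq V] {x y w w' : V}
    (h : G.IsSolePath x y w) (h' : G.IsSolePath w' x y) :
    (G.deleteArc x y).IsOrientedColouring
      (fun z => if z = w then x else if z = w' then y else z) := by
  have hi := G.irrefl
  have ha := G.asymm
  obtain ⟨a1, a2, a3, a4, a5, a6⟩ := h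
  obtain ⟨b1, b2, b3, b4, b5, b6⟩ := h'
  constructor
  · rintro p q ⟨hpq, hne⟩
    grind
  · rintro p q r s ⟨hpq, hne⟩ ⟨hrs, hne'⟩
    have := a5 p
    have := a5 q
    have := a6 p
    have := a6 q
    have := b5 p
    have := b5 q
    have := b6 p
    have := b6 q
    grind

/-- Otherwise giving `y` a new colour would turn `φ` into an oriented colouring of `G`. -/
theorem exists_same_colour_left [Fintype V] {G : OrientedGraph V} {x y : V} (hxy : G.Adj x y)
    {k : ℕ} {φ : V → Fin k} (hφ : (G.deleteArc x y).IsOrientedColouring φ)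
    (hk : k + 1 < G.orientedChromaticNumber) : ∃ w, w ≠ x ∧ w ≠ y ∧ φ w = φ x := by
  classical
  by_contra! hw
  have hc : G.IsOrientedColouring (fun z => if z = y then none else some (φ z)) := by
    have h1 : ∀ p q, p ≠ x ∨ q ≠ y → G.Adj p q → (G.deleteArc x y).Adj p q :=
      fun p q h h' => ⟨h', fun h'' => h.elim (· h''.1) (· h''.2)⟩
    have hi := G.irrefl
    have ha := G.asymm
    obtain ⟨h3, h4⟩ := hφ
    constructor
    · intro p q hpq
      have := h3 p q
      grind
    · intro p q r s hpq hrs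
      have := h4 p q r s
      grind
  have h1 := (G.orientedChromaticNumber_le hc).trans (Finset.card_le_univ _)
  simp at h1
  omega

/-- Otherwise giving `x` a new colour would turn `φ` into an oriented colouring of `G`. -/
theorem exists_same_colour_right [Fintype V] {G : OrientedGraph V} {x y : V} (hxy : G.Adj x y)
    {k : ℕ} {φ : V → Fin k} (hφ : (G.deleteArc x y).IsOrientedColouring φ)
    (hk : k + 1 < G.orientedChromaticNumber) : ∃ w, w ≠ x ∧ w ≠ y ∧ φ w = φ y := by
  classical
  by_contra! hw
  have hc : G.IsOrientedColouring (fun z => if z = x then none else some (φ z)) := by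
    have h1 : ∀ p q, p ≠ x ∨ q ≠ y → G.Adj p q → (G.deleteArc x y).Adj p q :=
      fun p q h h' => ⟨h', fun h'' => h.elim (· h''.1) (· h''.2)⟩
    have hi := G.irrefl
    have ha := G.asymm
    obtain ⟨h3, h4⟩ := hφ
    constructor
    · intro p q hpq
      have := h3 p q
      grind
    · intro p q r s hpq hrs
      have := h4 p q r s
      grind
  have h1 := (G.orientedChromaticNumber_le hc).trans (Finset.card_le_univ _)
  simp at h1
  omega

/-- As `w` and `x` see each other in `G` but not in `G - xy`, they do so over the arc `xy` only. -/
theorem isSolePath_of_same_colour_left {G : OrientedGraph V} (hs : ∀ u v, u ≠ v → G.Sees u v)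
    {x y w : V} {C : Type*} {φ : V → C} (hφ : (G.deleteArc x y).IsOrientedColouring φ)
    (hx : w ≠ x) (hy : w ≠ y) (e : φ w = φ x) : G.IsSolePath x y w := by
  have h := hφ.not_sees e
  have h2 := hs w x hx
  have hi := G.irrefl
  have ha := G.asymm
  simp only [Sees, deleteArc] at h h2
  push Not at h
  obtain ⟨c1, c2, c3⟩ := h
  obtain ⟨d1, d2⟩ : G.Adj x y ∧ G.Adj y w := by grind
  exact ⟨d1, d2, by grind, by grind, by grind, by grind⟩

theorem isSolePath_of_same_colour_right {G : OrientedGraph V} (hs : ∀ u v, u ≠ v → G.Sees u v)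
    {x y w : V} {C : Type*} {φ : V → C} (hφ : (G.deleteArc x y).IsOrientedColouring φ)
    (hx : w ≠ x) (hy : w ≠ y) (e : φ w = φ y) : G.IsSolePath w x y := by
  have h := hφ.not_sees e
  have h2 := hs w y hy
  have hi := G.irrefl
  have ha := G.asymm
  simp only [Sees, deleteArc] at h h2
  push Not at h
  obtain ⟨c1, c2, c3⟩ := h
  obtain ⟨d1, d2⟩ : G.Adj w x ∧ G.Adj x y := by grind
  exact ⟨d1, d2, by grind, by grind, by grind, by grind⟩

/-- The description of deeply critical oriented cliques without colourings. -/
theorem isDeeplyCriticalOrientedClique_iff [Fintype V] (G : OrientedGraph V) :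
    G.IsDeeplyCriticalOrientedClique ↔ (∀ u v, u ≠ v → G.Sees u v) ∧
      ∀ x y, G.Adj x y → (∃ w, G.IsSolePath x y w) ∧ ∃ w, G.IsSolePath w x y := by
  classical
  rw [IsDeeplyCriticalOrientedClique, isAbsoluteOrientedClique_iff]
  refine and_congr_right fun hs => ⟨fun h x y hxy => ?_, fun h x y hxy => ?_⟩
  · have hk := h x y hxy
    obtain ⟨φ, hφ⟩ := (G.deleteArc x y).exists_colouring
    obtain ⟨w, h1, h2, h3⟩ := exists_same_colour_left hxy hφ (by omega)
    obtain ⟨w', h1', h2', h3'⟩ := exists_same_colour_right hxy hφ (by omega)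
    exact ⟨⟨w, isSolePath_of_same_colour_left hs hφ h1 h2 h3⟩,
      ⟨w', isSolePath_of_same_colour_right hs hφ h1' h2' h3'⟩⟩
  · obtain ⟨⟨w, hw⟩, w', hw'⟩ := h x y hxy
    refine le_antisymm ?_ (G.orientedChromaticNumber_le_deleteArc_add_two x y)
    rw [(G.isAbsoluteOrientedClique_iff.2 hs : G.orientedChromaticNumber = _)]
    have h1 := orientedChromaticNumber_le _ (deleteArc_colouring_of_solePath hw hw')
    have hi := G.irrefl
    have ha := G.asymm
    obtain ⟨a1, a2, a3, a4, a5, a6⟩ := hw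
    obtain ⟨b1, b2, b3, b4, b5, b6⟩ := hw'
    have h2 := card_image_le_sub_two (φ := fun z => if z = w then x else if z = w' then y else z)
      (a := w) (b := w') (by grind) (by intro z; grind) (by intro z; grind)
    omega

/-! ### Degrees and the orders three and seven -/

open Classical in
/-- Each arc at `x` is a part of the only directed path of length two from or to a further vertex,
and these vertices are distinct and not adjacent to `x`. Thus the degree of `x` is at most half the
number of the other vertices. -/
theorem two_mul_degree_add_one_le [Fintype V] {G : OrientedGraph V}
    (h : ∀ x y, G.Adj x y → (∃ w, G.IsSolePath x y w) ∧ ∃ w, G.IsSolePath w x y) (x : V) :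
    2 * ((Finset.univ.filter (G.Adj x ·)).card + (Finset.univ.filter (G.Adj · x)).card) + 1 ≤
      Fintype.card V := by
  set O := Finset.univ.filter (G.Adj x ·) with hO
  set I := Finset.univ.filter (G.Adj · x) with hI
  set S := Finset.univ.filter (fun w => ∃ y, G.IsSolePath x y w) with hS
  set T := Finset.univ.filter (fun w => ∃ y, G.IsSolePath w y x) with hT
  have hOS : O.card ≤ S.card := by
    refine Finset.card_le_card_of_forall_subsingleton (fun y w => G.IsSolePath x y w) ?_ ?_
    · intro y hy
      obtain ⟨w, hw⟩ := (h x y (by simpa [hO] using hy)).1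
      exact ⟨w, by simpa [hS] using ⟨y, hw⟩, hw⟩
    · rintro w - y ⟨-, hy⟩ y' ⟨-, hy'⟩
      exact hy'.eq_of_adj y hy.fst hy.snd
  have hIT : I.card ≤ T.card := by
    refine Finset.card_le_card_of_forall_subsingleton (fun y w => G.IsSolePath w y x) ?_ ?_
    · intro y hy
      obtain ⟨w, hw⟩ := (h y x (by simpa [hI] using hy)).2
      exact ⟨w, by simpa [hT] using ⟨y, hw⟩, hw⟩
    · rintro w - y ⟨-, hy⟩ y' ⟨-, hy'⟩
      exact hy'.eq_of_adj y hy.fst hy.snd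
  have hi := G.irrefl
  have ha := G.asymm
  have d1 : Disjoint O I := by
    rw [Finset.disjoint_left]; intro z; simp only [hO, hI, Finset.mem_filter]; grind
  have d2 : Disjoint (O ∪ I) S := by
    rw [Finset.disjoint_left]; intro z hz hz'
    simp only [hO, hI, hS, Finset.mem_union, Finset.mem_filter] at hz hz'
    obtain ⟨-, y, hy⟩ := hz'
    have := hy.not_adj
    have := hy.not_adj'
    grind
  have d3 : Disjoint (O ∪ I ∪ S) T := by
    rw [Finset.disjoint_left]; intro z hz hz'
    simp only [hO, hI, hS, hT, Finset.mem_union, Finset.mem_filter] at hz hz'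
    obtain ⟨-, y, hy⟩ := hz'
    rcases hz with hz | ⟨-, y', hy'⟩
    · have := hy.not_adj
      have := hy.not_adj'
      grind
    · exact hy.not_path y' hy'.fst hy'.snd
  have hx : O ∪ I ∪ S ∪ T ⊆ Finset.univ.erase x := by
    intro z hz
    refine Finset.mem_erase.2 ⟨?_, Finset.mem_univ z⟩
    rintro rfl
    simp only [hO, hI, hS, hT, Finset.mem_union, Finset.mem_filter] at hz
    rcases hz with ((hz | hz) | ⟨-, y, hy⟩) | ⟨-, y, hy⟩
    · exact hi _ hz.2
    · exact hi _ hz.2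
    · exact ha _ _ hy.fst hy.snd
    · exact ha _ _ hy.fst hy.snd
  have h1 := Finset.card_le_card hx
  have h2 := Finset.card_erase_add_one (Finset.mem_univ x)
  rw [Finset.card_union_of_disjoint d3, Finset.card_union_of_disjoint d2,
    Finset.card_union_of_disjoint d1] at h1
  rw [Finset.card_univ] at h2
  omega

/-- There are no sources and no sinks. -/
theorem exists_adj_of_nontrivial [Nontrivial V] {G : OrientedGraph V}
    (hs : ∀ u v, u ≠ v → G.Sees u v)
    (h : ∀ x y, G.Adj x y → (∃ w, G.IsSolePath x y w) ∧ ∃ w, G.IsSolePath w x y) (x : V) :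
    (∃ y, G.Adj x y) ∧ ∃ y, G.Adj y x := by
  obtain ⟨z, hz⟩ := exists_ne x
  have h1 : (∃ y, G.Adj x y) ∨ ∃ y, G.Adj y x := by
    rcases hs x z hz.symm with h1 | h1 | ⟨y, ⟨h1, -⟩ | ⟨-, h1⟩⟩
    exacts [.inl ⟨_, h1⟩, .inr ⟨_, h1⟩, .inl ⟨_, h1⟩, .inr ⟨_, h1⟩]
  rcases h1 with ⟨y, hy⟩ | ⟨y, hy⟩
  · obtain ⟨w, hw⟩ := (h x y hy).2
    exact ⟨⟨y, hy⟩, w, hw.fst⟩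
  · obtain ⟨w, hw⟩ := (h y x hy).1
    exact ⟨⟨w, hw.snd⟩, y, hy⟩

/-- The shape of a deeply critical oriented clique of order seven around a vertex `v` whose only
neighbours are `u → v` and `v → w`: the other vertices are the out-neighbours `a`, `a'` of `w` and
the in-neighbours `b`, `b'` of `u`, and the arcs from `{a, a'}` to `{b, b'}` are `a → b` and
`a' → b'`. -/
structure IsSevenConfig (G : OrientedGraph V) (u v w a a' b b' : V) : Prop where
  cover : ∀ z, z = u ∨ z = v ∨ z = w ∨ z = a ∨ z = a' ∨ z = b ∨ z = b'
  mid : G.IsSolePath u v w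
  in_mid : ∀ z, G.Adj z v → z = u
  out_mid : ∀ z, G.Adj v z → z = w
  sole : G.IsSolePath w a b
  sole' : G.IsSolePath w a' b'
  sole_in : G.IsSolePath a b u
  sole_in' : G.IsSolePath a' b' u
  ne : a ≠ a'

theorem IsSevenConfig.swap {G : OrientedGraph V} {u v w a a' b b' : V}
    (h : G.IsSevenConfig u v w a a' b b') : G.IsSevenConfig u v w a' a b' b where
  cover z := by have := h.cover z; tauto
  mid := h.mid
  in_mid := h.in_mid
  out_mid := h.out_mid
  sole := h.sole'
  sole' := h.sole
  sole_in := h.sole_in'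
  sole_in' := h.sole_in
  ne := h.ne.symm

theorem IsSevenConfig.eq_of_left_adj {G : OrientedGraph V} {u v w a a' b b' : V}
    (h : G.IsSevenConfig u v w a a' b b') {z : V} (hz : G.Adj a z) : z = a' ∨ z = b := by
  have ha := G.asymm
  have hi := G.irrefl
  obtain ⟨h1, ⟨m1, m2, m3, m4, m5, m6⟩, h3, h4, ⟨s1, s2, s3, s4, s5, s6⟩,
    ⟨t1, t2, t3, t4, t5, t6⟩, ⟨p1, p2, p3, p4, p5, p6⟩, ⟨q1, q2, q3, q4, q5, q6⟩, ne⟩ := h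
  have := h1 z
  grind

theorem IsSevenConfig.eq_of_adj_right {G : OrientedGraph V} {u v w a a' b b' : V}
    (h : G.IsSevenConfig u v w a a' b b') {z : V} (hz : G.Adj z b) : z = b' ∨ z = a := by
  have ha := G.asymm
  have hi := G.irrefl
  obtain ⟨h1, ⟨m1, m2, m3, m4, m5, m6⟩, h3, h4, ⟨s1, s2, s3, s4, s5, s6⟩,
    ⟨t1, t2, t3, t4, t5, t6⟩, ⟨p1, p2, p3, p4, p5, p6⟩, ⟨q1, q2, q3, q4, q5, q6⟩, ne⟩ := h
  have := h1 z
  grind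

theorem IsSevenConfig.eq_of_adj_left {G : OrientedGraph V} {u v w a a' b b' : V}
    (h : G.IsSevenConfig u v w a a' b b') {z : V} (hz : G.Adj z a) : z = w ∨ z = a' ∨ z = b' := by
  have ha := G.asymm
  have hi := G.irrefl
  obtain ⟨h1, ⟨m1, m2, m3, m4, m5, m6⟩, h3, h4, ⟨s1, s2, s3, s4, s5, s6⟩,
    ⟨t1, t2, t3, t4, t5, t6⟩, ⟨p1, p2, p3, p4, p5, p6⟩, ⟨q1, q2, q3, q4, q5, q6⟩, ne⟩ := h
  have := h1 z
  grind

/-- An arc `b → a'` would require the sole paths `a → b → a'` and `b → a' → b'`, which leave no way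
for `a` and `b'` to see each other. -/
theorem IsSevenConfig.not_adj_back {G : OrientedGraph V} (hs : ∀ u v, u ≠ v → G.Sees u v)
    (hc : ∀ x y, G.Adj x y → (∃ w, G.IsSolePath x y w) ∧ ∃ w, G.IsSolePath w x y)
    {u v w a a' b b' : V} (h : G.IsSevenConfig u v w a a' b b') : ¬ G.Adj b a' := by
  intro hba
  have ha := G.asymm
  have hi := G.irrefl
  obtain ⟨⟨y, hy⟩, x, hx⟩ := hc b a' hba
  -- the only extension of `b → a'` to the right ends in `b'`, that to the left starts in `a`
  have hab := h.sole.snd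
  have hyb : y = b' := by
    rcases h.swap.eq_of_left_adj hy.snd with rfl | rfl
    · exact absurd hab hy.not_adj'
    · rfl
  subst hyb
  have hxa : x = a := by
    rcases h.eq_of_adj_right hx.fst with rfl | rfl
    · exact absurd hx.fst hy.not_adj'
    · rfl
  subst hxa
  have hne : x ≠ y := by
    rintro rfl
    exact hx.not_adj' h.sole'.snd
  rcases hs x y hne with h1 | h1 | ⟨z, ⟨h1, h2⟩ | ⟨h1, h2⟩⟩
  · rcases h.eq_of_left_adj h1 with h2 | h2
    · exact hi _ (h2 ▸ h.sole'.snd)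
    · exact ha _ _ hba (h2 ▸ h.sole'.snd)
  · exact hx.not_path y h.sole'.snd h1
  · rcases h.eq_of_left_adj h1 with rfl | rfl
    · exact hx.not_adj h1
    · exact hy.not_adj h2
  · rcases h.eq_of_adj_left h2 with rfl | rfl | rfl
    · exact h.sole'.not_adj' h1
    · exact hx.not_adj' h2
    · exact hi _ h1

/-- The in-neighbours of `a` leave no sole path to `a'` over an arc `a → a'`. -/
theorem IsSevenConfig.not_adj_first {G : OrientedGraph V} (hs : ∀ u v, u ≠ v → G.Sees u v)
    (hc : ∀ x y, G.Adj x y → (∃ w, G.IsSolePath x y w) ∧ ∃ w, G.IsSolePath w x y)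
    {u v w a a' b b' : V} (h : G.IsSevenConfig u v w a a' b b') : ¬ G.Adj a a' := by
  intro haa
  obtain ⟨x, hx⟩ := (hc a a' haa).2
  rcases h.eq_of_adj_left hx.fst with rfl | rfl | rfl
  · exact hx.not_adj h.sole'.fst
  · exact G.asymm _ _ haa hx.fst
  · exact h.swap.not_adj_back hs hc hx.fst

/-- The vertices `a` and `a'` cannot see each other. -/
theorem not_isSevenConfig {G : OrientedGraph V} (hs : ∀ u v, u ≠ v → G.Sees u v)
    (hc : ∀ x y, G.Adj x y → (∃ w, G.IsSolePath x y w) ∧ ∃ w, G.IsSolePath w x y)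
    {u v w a a' b b' : V} : ¬ G.IsSevenConfig u v w a a' b b' := by
  intro h
  rcases hs a a' h.ne with h1 | h1 | ⟨z, ⟨h1, h2⟩ | ⟨h1, h2⟩⟩
  · exact h.not_adj_first hs hc h1
  · exact h.swap.not_adj_first hs hc h1
  · rcases h.eq_of_left_adj h1 with rfl | rfl
    · exact G.irrefl _ h2
    · exact h.not_adj_back hs hc h2
  · rcases h.swap.eq_of_left_adj h1 with rfl | rfl
    · exact G.irrefl _ h2
    · exact h.swap.not_adj_back hs hc h2

open Classical in
/-- By the handshake lemma not all seven degrees are equal to three. -/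
theorem exists_in_out_eq_singleton [Fintype V] {G : OrientedGraph V} (h7 : Fintype.card V = 7)
    (hs : ∀ u v, u ≠ v → G.Sees u v)
    (hc : ∀ x y, G.Adj x y → (∃ w, G.IsSolePath x y w) ∧ ∃ w, G.IsSolePath w x y) :
    ∃ u v w, (∀ z, G.Adj z v ↔ z = u) ∧ ∀ z, G.Adj v z ↔ z = w := by
  have : Nontrivial V := Fintype.one_lt_card_iff_nontrivial.1 (by omega)
  have hsum : ∑ x : V, (Finset.univ.filter (G.Adj x ·)).card =
      ∑ x : V, (Finset.univ.filter (G.Adj · x)).card :=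
    Finset.sum_card_bipartiteAbove_eq_sum_card_bipartiteBelow (s := Finset.univ)
      (t := Finset.univ) G.Adj
  have hpos : ∀ x, 0 < (Finset.univ.filter (G.Adj x ·)).card ∧
      0 < (Finset.univ.filter (G.Adj · x)).card := by
    intro x
    obtain ⟨⟨y, hy⟩, z, hz⟩ := exists_adj_of_nontrivial hs hc x
    exact ⟨Finset.card_pos.2 ⟨y, by simpa using hy⟩, Finset.card_pos.2 ⟨z, by simpa using hz⟩⟩
  obtain ⟨v, hv⟩ : ∃ v, (Finset.univ.filter (G.Adj v ·)).card +
      (Finset.univ.filter (G.Adj · v)).card ≠ 3 := by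
    by_contra! hall
    have h1 : ∑ x : V, ((Finset.univ.filter (G.Adj x ·)).card +
        (Finset.univ.filter (G.Adj · x)).card) = 21 := by
      rw [Finset.sum_congr rfl fun x _ => hall x, Finset.sum_const, Finset.card_univ, h7]
      rfl
    rw [Finset.sum_add_distrib] at h1
    omega
  have hle := two_mul_degree_add_one_le hc v
  obtain ⟨p1, p2⟩ := hpos v
  obtain ⟨w, hw⟩ := Finset.card_eq_one.1
    (show (Finset.univ.filter (G.Adj v ·)).card = 1 by omega)
  obtain ⟨u, hu⟩ := Finset.card_eq_one.1
    (show (Finset.univ.filter (G.Adj · v)).card = 1 by omega)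
  refine ⟨u, v, w, fun z => ?_, fun z => ?_⟩
  · simpa using congrArg (z ∈ ·) hu
  · simpa using congrArg (z ∈ ·) hw

open Classical in
theorem exists_isSevenConfig [Fintype V] {G : OrientedGraph V} (h7 : Fintype.card V = 7)
    (hs : ∀ u v, u ≠ v → G.Sees u v)
    (hc : ∀ x y, G.Adj x y → (∃ w, G.IsSolePath x y w) ∧ ∃ w, G.IsSolePath w x y) :
    ∃ u v w a a' b b', G.IsSevenConfig u v w a a' b b' := by
  obtain ⟨u, v, w, hu, hw⟩ := exists_in_out_eq_singleton h7 hs hc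
  have ha := G.asymm
  have hi := G.irrefl
  have huv : G.Adj u v := (hu u).2 rfl
  have hvw : G.Adj v w := (hw w).2 rfl
  have mid : G.IsSolePath u v w := by
    obtain ⟨x, hx⟩ := (hc v w hvw).2
    rwa [(hu x).1 hx.fst] at hx
  obtain ⟨-, -, m3, m4, m5, m6⟩ := id mid
  have hsplit : ∀ z, z ≠ u → z ≠ v → z ≠ w → (G.Adj w z ∨ G.Adj z u) := by
    intro z z1 z2 z3
    rcases hs v z z2.symm with h1 | h1 | ⟨y, ⟨h1, h2⟩ | ⟨h1, h2⟩⟩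
    · exact absurd ((hw z).1 h1) z3
    · exact absurd ((hu z).1 h1) z1
    · exact .inl ((hw y).1 h1 ▸ h2)
    · exact .inr ((hu y).1 h2 ▸ h1)
  -- a non-neighbour at distance two from `w` lies behind `u`
  have hA : ∀ a, G.Adj w a → ∃ b, G.IsSolePath w a b ∧ G.Adj b u := by
    intro a h
    obtain ⟨b, hb⟩ := (hc w a h).1
    obtain ⟨b1, b2, b3, b4, b5, b6⟩ := id hb
    have := hsplit b
    exact ⟨b, hb, by grind⟩
  have hB : ∀ b, G.Adj b u → ∃ a, G.IsSolePath a b u ∧ G.Adj w a := by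
    intro b h
    obtain ⟨a, haa⟩ := (hc b u h).2
    obtain ⟨b1, b2, b3, b4, b5, b6⟩ := id haa
    have := hsplit a
    exact ⟨a, haa, by grind⟩
  set A := Finset.univ.filter (G.Adj w ·) with hAd
  set B := Finset.univ.filter (G.Adj · u) with hBd
  have hAB : A.card ≤ B.card := by
    refine Finset.card_le_card_of_forall_subsingleton (fun a b => G.IsSolePath w a b) ?_ ?_
    · intro a h
      obtain ⟨b, hb, hbu⟩ := hA a (by simpa [hAd] using h)
      exact ⟨b, by simpa [hBd] using hbu, hb⟩
    · rintro b - y ⟨-, hy⟩ y' ⟨-, hy'⟩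
      exact hy'.eq_of_adj y hy.fst hy.snd
  have hBA : B.card ≤ A.card := by
    refine Finset.card_le_card_of_forall_subsingleton (fun b a => G.IsSolePath a b u) ?_ ?_
    · intro b h
      obtain ⟨a, haa, hwa⟩ := hB b (by simpa [hBd] using h)
      exact ⟨a, by simpa [hAd] using hwa, haa⟩
    · rintro b - y ⟨-, hy⟩ y' ⟨-, hy'⟩
      exact hy'.eq_of_adj y hy.fst hy.snd
  have hd : Disjoint A B := by
    rw [Finset.disjoint_left]; intro z h1 h2
    simp only [hAd, hBd, Finset.mem_filter] at h1 h2
    exact m6 z h1.2 h2.2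
  have hne : u ≠ v ∧ u ≠ w ∧ v ≠ w := by grind
  have hcard : A.card + B.card = 4 := by
    rw [← Finset.card_union_of_disjoint hd]
    have h1 : A ∪ B = ({u, v, w} : Finset V)ᶜ := by
      ext z
      simp only [hAd, hBd, Finset.mem_union, Finset.mem_filter, Finset.mem_compl,
        Finset.mem_insert, Finset.mem_singleton, Finset.mem_univ, true_and]
      have := hsplit z
      grind
    rw [h1, Finset.card_compl, h7, Finset.card_eq_three.2 ⟨u, v, w, hne.1, hne.2.1, hne.2.2, rfl⟩]
  obtain ⟨a, a', haa, hA2⟩ := Finset.card_eq_two.1 (show A.card = 2 by omega)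
  have hA3 : ∀ z, G.Adj w z ↔ z = a ∨ z = a' := by
    intro z
    simpa [hAd] using congrArg (z ∈ ·) hA2
  obtain ⟨b, hb, hbu⟩ := hA a ((hA3 a).2 (.inl rfl))
  obtain ⟨b', hb', hbu'⟩ := hA a' ((hA3 a').2 (.inr rfl))
  have hbb : b ≠ b' := by
    rintro rfl
    exact haa (hb'.eq_of_adj a hb.fst hb.snd)
  have hB2 : {b, b'} = B := by
    refine Finset.eq_of_subset_of_card_le ?_ ?_
    · intro z hz
      simp only [Finset.mem_insert, Finset.mem_singleton] at hz
      rcases hz with rfl | rfl <;> simpa [hBd]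
    · rw [Finset.card_pair hbb]; omega
  have hB3 : ∀ z, G.Adj z u ↔ z = b ∨ z = b' := by
    intro z
    have := congrArg (z ∈ ·) hB2
    simp [hBd] at this
    exact this.symm
  refine ⟨u, v, w, a, a', b, b', ?_, mid, fun z => (hu z).1, fun z => (hw z).1, hb, hb', ?_, ?_,
    haa⟩
  · intro z
    have := hsplit z
    have := hA3 z
    have := hB3 z
    tauto
  · obtain ⟨x, hx, hwx⟩ := hB b hbu
    rwa [hb.eq_of_adj x hwx hx.fst] at hx
  · obtain ⟨x, hx, hwx⟩ := hB b' hbu'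
    rwa [hb'.eq_of_adj x hwx hx.fst] at hx

theorem not_isDeeplyCriticalOrientedClique_of_card_eq_three [Fintype V] (h3 : Fintype.card V = 3)
    (G : OrientedGraph V) : ¬ G.IsDeeplyCriticalOrientedClique := by
  classical
  rw [isDeeplyCriticalOrientedClique_iff]
  rintro ⟨hs, hc⟩
  have : Nontrivial V := Fintype.one_lt_card_iff_nontrivial.1 (by omega)
  obtain ⟨x⟩ : Nonempty V := inferInstance
  obtain ⟨⟨y, hy⟩, z, hz⟩ := exists_adj_of_nontrivial hs hc x
  have h1 := two_mul_degree_add_one_le hc x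
  have h2 : 0 < (Finset.univ.filter (G.Adj x ·)).card :=
    Finset.card_pos.2 ⟨y, by simpa using hy⟩
  have h3 : 0 < (Finset.univ.filter (G.Adj · x)).card :=
    Finset.card_pos.2 ⟨z, by simpa using hz⟩
  omega

theorem not_isDeeplyCriticalOrientedClique_of_card_eq_seven [Fintype V]
    (h7 : Fintype.card V = 7) (G : OrientedGraph V) : ¬ G.IsDeeplyCriticalOrientedClique := by
  rw [isDeeplyCriticalOrientedClique_iff]
  rintro ⟨hs, hc⟩
  obtain ⟨u, v, w, a, a', b, b', h⟩ := exists_isSevenConfig h7 hs hc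
  exact not_isSevenConfig hs hc h

/-! ### A core with linearly ordered blocks -/

/-- The arcs inside a block of four vertices: the path `0 → 1 → 2 → 3` and the arc `0 → 3`. -/
def blockArcs : Fin 4 → List (Fin 4) := ![[1, 3], [2], [3], []]

/-- The arcs from a block to a later one. -/
def forwardArcs : Fin 4 → List (Fin 4) := ![[], [], [1], [0]]

/-- The arcs from a block to an earlier one. -/
def backwardArcs : Fin 4 → List (Fin 4) := ![[], [], [0], [1]]

/-- An oriented graph on `Fin c`, called the core, and the arcs between it and a block of four
vertices, all given by lists of out-neighbours. -/
structure CoreData (c : ℕ) where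
  /-- The arcs inside the core. -/
  arcs : Fin c → List (Fin c)
  /-- The arcs from the core to a block. -/
  toBlock : Fin c → List (Fin 4)
  /-- The arcs from a block to the core. -/
  fromBlock : Fin 4 → List (Fin c)

namespace CoreData

variable {c : ℕ} (C : CoreData c)

/-- The arcs of the graph consisting of the core and a linearly ordered family of blocks. All blocks
are attached to the core in the same way, and the arcs between two blocks depend only on their
order. -/
def Arc {ι : Type} [LinearOrder ι] : Fin c ⊕ ι × Fin 4 → Fin c ⊕ ι × Fin 4 → Prop
  | .inl a, .inl b => b ∈ C.arcs a
  | .inl a, .inr (_, t) => t ∈ C.toBlock a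
  | .inr (_, s), .inl b => b ∈ C.fromBlock s
  | .inr (i, s), .inr (j, t) =>
    (i < j ∧ t ∈ forwardArcs s) ∨ (j < i ∧ t ∈ backwardArcs s) ∨ (i = j ∧ t ∈ blockArcs s)

instance {ι : Type} [LinearOrder ι] : DecidableRel (C.Arc (ι := ι))
  | .inl a, .inl b => inferInstanceAs (Decidable (b ∈ C.arcs a))
  | .inl a, .inr (_, t) => inferInstanceAs (Decidable (t ∈ C.toBlock a))
  | .inr (_, s), .inl b => inferInstanceAs (Decidable (b ∈ C.fromBlock s))
  | .inr (i, s), .inr (j, t) => inferInstanceAs (Decidable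
    ((i < j ∧ t ∈ forwardArcs s) ∨ (j < i ∧ t ∈ backwardArcs s) ∨ (i = j ∧ t ∈ blockArcs s)))

/-- The map on vertices induced by a map of the index sets of the blocks. -/
def mapBlocks {ι κ : Type} (f : ι → κ) : Fin c ⊕ ι × Fin 4 → Fin c ⊕ κ × Fin 4
  | .inl a => .inl a
  | .inr (i, t) => .inr (f i, t)

/-- The position `2 j + 1` of the `j`-th of `m` points among these points and the `m + 1` gaps
around them. -/
def oddPos {m : ℕ} (j : Fin m) : Fin (2 * m + 1) := ⟨2 * j + 1, by omega⟩

/-- The path from `x` over `y` to `w` is a sole path, however many blocks are added to the `m` given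
ones: a further vertex `z` is represented by its type and its block by a gap. -/
def IsStableSolePath {m : ℕ} (x y w : Fin c ⊕ Fin m × Fin 4) : Prop :=
  C.Arc x y ∧ C.Arc y w ∧ ¬ C.Arc x w ∧ ¬ C.Arc w x ∧
    (∀ z, C.Arc (mapBlocks oddPos x) z → C.Arc z (mapBlocks oddPos w) → z = mapBlocks oddPos y) ∧
    ∀ z, C.Arc (mapBlocks oddPos w) z → ¬ C.Arc z (mapBlocks oddPos x)

/-- The graph with `m` blocks has the properties of a deeply critical oriented clique, with sole
paths that persist when more blocks are added. -/
def IsStable (m : ℕ) : Prop :=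
  ∀ x y : Fin c ⊕ Fin m × Fin 4,
    (C.Arc x y → ¬ C.Arc y x ∧ (∃ w, C.IsStableSolePath x y w) ∧ ∃ w, C.IsStableSolePath w x y) ∧
    (x = y ∨ C.Arc x y ∨ C.Arc y x ∨ ∃ z, (C.Arc x z ∧ C.Arc z y) ∨ (C.Arc y z ∧ C.Arc z x))

instance {m : ℕ} (x y w : Fin c ⊕ Fin m × Fin 4) : Decidable (C.IsStableSolePath x y w) := by
  unfold IsStableSolePath; infer_instance

instance (m : ℕ) : Decidable (C.IsStable m) := by
  unfold IsStable; infer_instance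

/-! ### From two blocks to arbitrarily many -/

theorem eq_mapBlocks {μ ι κ : Type} {f : μ → ι} {g : μ → κ} {ρ : ι → κ}
    (h : ∀ i l, ρ l = g i → l = f i) {z : Fin c ⊕ ι × Fin 4} {x : Fin c ⊕ μ × Fin 4}
    (e : mapBlocks ρ z = mapBlocks g x) : z = mapBlocks f x := by
  rcases x with a | ⟨i, s⟩ <;> rcases z with b | ⟨j, t⟩ <;>
    simp only [mapBlocks, reduceCtorEq, Sum.inl.injEq, Sum.inr.injEq, Prod.mk.injEq] at e ⊢
  · exact e
  · exact ⟨h i j e.1, e.2⟩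

section Transfer

variable {ι κ : Type} [LinearOrder ι] [LinearOrder κ]

theorem arc_mapBlocks {μ : Type} [LinearOrder μ] {f : μ → ι} {g : μ → κ} {ρ : ι → κ}
    (h₁ : ∀ i l, f i < l ↔ g i < ρ l) (h₂ : ∀ i l, l < f i ↔ ρ l < g i)
    (x : Fin c ⊕ μ × Fin 4) (z : Fin c ⊕ ι × Fin 4) :
    C.Arc (mapBlocks f x) z ↔ C.Arc (mapBlocks g x) (mapBlocks ρ z) := by
  have h₃ : ∀ i l, f i = l ↔ g i = ρ l := fun i l => by
    have := h₁ i l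
    have := h₂ i l
    grind
  rcases x with a | ⟨i, s⟩ <;> rcases z with b | ⟨j, t⟩ <;>
    simp only [mapBlocks, Arc, h₁, h₂, h₃]

theorem mapBlocks_arc {μ : Type} [LinearOrder μ] {f : μ → ι} {g : μ → κ} {ρ : ι → κ}
    (h₁ : ∀ i l, f i < l ↔ g i < ρ l) (h₂ : ∀ i l, l < f i ↔ ρ l < g i)
    (z : Fin c ⊕ ι × Fin 4) (x : Fin c ⊕ μ × Fin 4) :
    C.Arc z (mapBlocks f x) ↔ C.Arc (mapBlocks ρ z) (mapBlocks g x) := by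
  have h₃ : ∀ i l, l = f i ↔ ρ l = g i := fun i l => by
    have := h₁ i l
    have := h₂ i l
    grind
  rcases x with a | ⟨i, s⟩ <;> rcases z with b | ⟨j, t⟩ <;>
    simp only [mapBlocks, Arc, h₁, h₂, h₃]

theorem arc_mapBlocks_mapBlocks {f : ι → κ} (hf : StrictMono f) (x y : Fin c ⊕ ι × Fin 4) :
    C.Arc (mapBlocks f x) (mapBlocks f y) ↔ C.Arc x y := by
  rcases x with a | ⟨i, s⟩ <;> rcases y with b | ⟨j, t⟩ <;>
    simp only [mapBlocks, Arc, hf.lt_iff_lt, hf.injective.eq_iff]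

/-- The position of `l` relative to the points `τ 0 < τ 1 < ⋯`: the number `2 j + 1` for `l = τ j`,
and an even number for the gaps. -/
theorem exists_position {m : ℕ} {τ : Fin m → ι} (hτ : StrictMono τ) :
    ∃ ρ : ι → Fin (2 * m + 1), (∀ j l, τ j < l ↔ oddPos j < ρ l) ∧
      ∀ j l, l < τ j ↔ ρ l < oddPos j := by
  let N : ι → ℕ := fun l =>
    (Finset.univ.filter (τ · < l)).card + (Finset.univ.filter (τ · ≤ l)).card
  have hN : ∀ l, N l < 2 * m + 1 := fun l => by
    have h₁ := Finset.card_le_univ (Finset.univ.filter (τ · < l))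
    have h₂ := Finset.card_le_univ (Finset.univ.filter (τ · ≤ l))
    simp only [Fintype.card_fin] at h₁ h₂
    simp only [N]
    omega
  have hgt : ∀ j l, τ j < l → 2 * (j : ℕ) + 1 < N l := fun j l h => by
    have h₁ : Finset.Iic j ⊆ Finset.univ.filter (τ · < l) := fun i hi => by
      simpa using (hτ.monotone (Finset.mem_Iic.1 hi)).trans_lt h
    have h₂ : Finset.Iic j ⊆ Finset.univ.filter (τ · ≤ l) := fun i hi => by
      simpa using ((hτ.monotone (Finset.mem_Iic.1 hi)).trans_lt h).le
    have h₁ := Finset.card_le_card h₁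
    have h₂ := Finset.card_le_card h₂
    simp only [Fin.card_Iic] at h₁ h₂
    simp only [N]
    omega
  have hlt : ∀ j l, l < τ j → N l < 2 * (j : ℕ) + 1 := fun j l h => by
    have h₁ : Finset.univ.filter (τ · < l) ⊆ Finset.Iio j := fun i hi => by
      simpa using hτ.lt_iff_lt.1 ((Finset.mem_filter.1 hi).2.trans h)
    have h₂ : Finset.univ.filter (τ · ≤ l) ⊆ Finset.Iio j := fun i hi => by
      simpa using hτ.lt_iff_lt.1 ((Finset.mem_filter.1 hi).2.trans_lt h)
    have h₁ := Finset.card_le_card h₁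
    have h₂ := Finset.card_le_card h₂
    simp only [Fin.card_Iio] at h₁ h₂
    simp only [N]
    omega
  have heq : ∀ j, N (τ j) = 2 * (j : ℕ) + 1 := fun j => by
    simp only [N, hτ.lt_iff_lt, hτ.le_iff_le, Finset.filter_gt_eq_Iio, Finset.filter_ge_eq_Iic,
      Fin.card_Iio, Fin.card_Iic]
    omega
  refine ⟨fun l => ⟨N l, hN l⟩, fun j l => ?_, fun j l => ?_⟩ <;>
    simp only [oddPos, Fin.mk_lt_mk]
  · refine ⟨hgt j l, fun h => ?_⟩
    by_contra hn
    rcases (not_lt.1 hn).lt_or_eq with h' | rfl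
    · exact absurd (hlt j l h') (by omega)
    · exact absurd (heq j) (by omega)
  · refine ⟨hlt j l, fun h => ?_⟩
    by_contra hn
    rcases (not_lt.1 hn).lt_or_eq with h' | rfl
    · exact absurd (hgt j l h') (by omega)
    · exact absurd (heq j) (by omega)

/-- Two vertices meet at most two blocks. -/
theorem exists_mapBlocks_eq (x y : Fin c ⊕ ι × Fin 4) :
    ∃ m ≤ 2, ∃ τ : Fin m → ι, StrictMono τ ∧ ∃ x' y', mapBlocks τ x' = x ∧ mapBlocks τ y' = y := by
  let S : Fin c ⊕ ι × Fin 4 → Finset ι := Sum.elim (fun _ => ∅) (fun p => {p.1})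
  have hS : ∀ z, (S z).card ≤ 1 := by rintro (a | ⟨i, s⟩) <;> simp [S]
  let U := S x ∪ S y
  have hz : ∀ z, S z ⊆ U → ∃ z', mapBlocks (U.orderEmbOfFin rfl) z' = z := by
    rintro (a | ⟨i, s⟩) h
    · exact ⟨.inl a, rfl⟩
    · have hi : i ∈ Set.range (U.orderEmbOfFin rfl) := by
        rw [Finset.range_orderEmbOfFin]
        exact h (Finset.mem_singleton_self i)
      obtain ⟨j, rfl⟩ := hi
      exact ⟨.inr (j, s), rfl⟩
  obtain ⟨x', hx'⟩ := hz x Finset.subset_union_left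
  obtain ⟨y', hy'⟩ := hz y Finset.subset_union_right
  refine ⟨U.card, (Finset.card_union_le _ _).trans ?_, U.orderEmbOfFin rfl,
    (U.orderEmbOfFin rfl).strictMono, x', y', hx', hy'⟩
  have := hS x
  have := hS y
  omega

end Transfer

/-- The oriented graph consisting of the core and `k` blocks. -/
def toOrientedGraph (h : ∀ m ≤ 2, C.IsStable m) (k : ℕ) :
    OrientedGraph (Fin c ⊕ Fin k × Fin 4) where
  Adj := C.Arc
  irrefl x hx := by
    obtain ⟨m, hm, τ, hτ, x, -, rfl, -⟩ := exists_mapBlocks_eq x x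
    rw [C.arc_mapBlocks_mapBlocks hτ] at hx
    exact ((h m hm x x).1 hx).1 hx
  asymm x y hxy hyx := by
    obtain ⟨m, hm, τ, hτ, x, y, rfl, rfl⟩ := exists_mapBlocks_eq x y
    rw [C.arc_mapBlocks_mapBlocks hτ] at hxy hyx
    exact ((h m hm x y).1 hxy).1 hyx

theorem IsStableSolePath.isSolePath {C : CoreData c} (h : ∀ m ≤ 2, C.IsStable m) {k m : ℕ}
    {τ : Fin m → Fin k} (hτ : StrictMono τ) {x y w : Fin c ⊕ Fin m × Fin 4}
    (hw : C.IsStableSolePath x y w) :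
    (C.toOrientedGraph h k).IsSolePath (mapBlocks τ x) (mapBlocks τ y) (mapBlocks τ w) := by
  obtain ⟨h₁, h₂, h₃, h₄, h₅, h₆⟩ := hw
  obtain ⟨ρ, hρ₁, hρ₂⟩ := exists_position hτ
  have he : ∀ j l, ρ l = oddPos j → l = τ j := fun j l e =>
    le_antisymm (not_lt.1 fun h => absurd ((hρ₁ j l).1 h) (by simp [e]))
      (not_lt.1 fun h => absurd ((hρ₂ j l).1 h) (by simp [e]))
  refine ⟨(C.arc_mapBlocks_mapBlocks hτ _ _).2 h₁, (C.arc_mapBlocks_mapBlocks hτ _ _).2 h₂,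
    fun h => h₃ ((C.arc_mapBlocks_mapBlocks hτ _ _).1 h),
    fun h => h₄ ((C.arc_mapBlocks_mapBlocks hτ _ _).1 h), fun z hz₁ hz₂ => ?_, fun z hz₁ hz₂ => ?_⟩
  · exact eq_mapBlocks he (h₅ _ ((C.arc_mapBlocks hρ₁ hρ₂ _ _).1 hz₁)
      ((C.mapBlocks_arc hρ₁ hρ₂ _ _).1 hz₂))
  · exact h₆ _ ((C.arc_mapBlocks hρ₁ hρ₂ _ _).1 hz₁) ((C.mapBlocks_arc hρ₁ hρ₂ _ _).1 hz₂)

theorem isDeeplyCriticalOrientedClique_toOrientedGraph (h : ∀ m ≤ 2, C.IsStable m) (k : ℕ) :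
    (C.toOrientedGraph h k).IsDeeplyCriticalOrientedClique := by
  rw [isDeeplyCriticalOrientedClique_iff]
  refine ⟨fun x y hxy => ?_, fun x y hxy => ?_⟩
  · obtain ⟨m, hm, τ, hτ, x, y, rfl, rfl⟩ := exists_mapBlocks_eq x y
    have ha := C.arc_mapBlocks_mapBlocks hτ
    rcases (h m hm x y).2 with rfl | h₁ | h₁ | ⟨z, ⟨h₁, h₂⟩ | ⟨h₁, h₂⟩⟩
    · exact absurd rfl hxy
    · exact .inl ((ha _ _).2 h₁)
    · exact .inr (.inl ((ha _ _).2 h₁))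
    · exact .inr (.inr ⟨mapBlocks τ z, .inl ⟨(ha _ _).2 h₁, (ha _ _).2 h₂⟩⟩)
    · exact .inr (.inr ⟨mapBlocks τ z, .inr ⟨(ha _ _).2 h₁, (ha _ _).2 h₂⟩⟩)
  · obtain ⟨m, hm, τ, hτ, x, y, rfl, rfl⟩ := exists_mapBlocks_eq x y
    obtain ⟨-, ⟨w, hw⟩, w', hw'⟩ := (h m hm x y).1 ((C.arc_mapBlocks_mapBlocks hτ _ _).1 hxy)
    exact ⟨⟨_, hw.isSolePath h hτ⟩, _, hw'.isSolePath h hτ⟩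

theorem exists_isDeeplyCriticalOrientedClique (h : ∀ m ≤ 2, C.IsStable m) (k : ℕ) :
    ∃ (V : Type) (_ : Fintype V) (G : OrientedGraph V),
      Fintype.card V = c + 4 * k ∧ G.IsDeeplyCriticalOrientedClique :=
  ⟨_, inferInstance, C.toOrientedGraph h k, by simp [mul_comm],
    C.isDeeplyCriticalOrientedClique_toOrientedGraph h k⟩

end CoreData

/-! ### The two cores -/

/-- The directed cycle of length five as a core. -/
def coreFive : CoreData 5 where
  arcs := ![[1], [2], [3], [4], [0]]
  toBlock := ![[], [0], [], [1], [0]]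
  fromBlock := ![[], [], [0], [2, 4]]

/-- A deeply critical oriented clique of order eleven as a core. -/
def coreEleven : CoreData 11 where
  arcs := ![[4, 6], [10], [0, 3, 8], [5, 7], [1], [0, 1], [7, 9], [4, 8], [5, 9], [3, 4], [2, 6]]
  toBlock := ![[], [], [], [], [0, 1], [0], [0], [], [], [], [1]]
  fromBlock := ![[], [], [2, 3, 8], [1, 2, 6]]

theorem coreFive_isStable : ∀ m ≤ 2, coreFive.IsStable m := by
  decide +kernel

theorem coreEleven_isStable : ∀ m ≤ 2, coreEleven.IsStable m := by
  decide +kernel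

end OrientedGraph

theorem theorem3 (n : ℕ) (hodd : Odd n) (hn : n ≠ 1) :
    (∃ (V : Type) (_ : Fintype V) (G : OrientedGraph V),
      Fintype.card V = n ∧ G.IsDeeplyCriticalOrientedClique) ↔ 5 ≤ n ∧ n ≠ 7 := by
  obtain ⟨l, rfl⟩ := hodd
  constructor
  · rintro ⟨V, _, G, hV, hG⟩
    refine ⟨?_, fun h7 =>
      OrientedGraph.not_isDeeplyCriticalOrientedClique_of_card_eq_seven (hV.trans h7) G hG⟩
    by_contra hlt
    exact OrientedGraph.not_isDeeplyCriticalOrientedClique_of_card_eq_three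
      (hV.trans (by omega)) G hG
  · rintro ⟨h5, h7⟩
    -- `2 l + 1` is `1` or `3` modulo `4`; in the second case it is at least `11`
    obtain ⟨k, hk | hk⟩ : ∃ k, 2 * l + 1 = 5 + 4 * k ∨ 2 * l + 1 = 11 + 4 * k := by
      rcases Nat.even_or_odd' l with ⟨j, rfl | rfl⟩
      · exact ⟨j - 1, .inl (by omega)⟩
      · exact ⟨j - 2, .inr (by omega)⟩
    · rw [hk]
      exact OrientedGraph.coreFive.exists_isDeeplyCriticalOrientedClique
        OrientedGraph.coreFive_isStable k
    · rw [hk]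
      exact OrientedGraph.coreEleven.exists_isDeeplyCriticalOrientedClique
        OrientedGraph.coreEleven_isStable k
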